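/- For a graph $G$ on $[n]=\{1,\dots,n\}$, an integer $k\ge 3$ and an edge $uv\in E(G)$, let $c_k(u,v;G)$ denote the number of $k$-cycles in $G$ that contain the edge $uv$. For an integer $m\ge 3$ and a real number $L>0$, let $\mathcal{G}_n(m,L)$ be the family of graphs $G$ on the vertex set $[n]$ such that $c_k(u,v;G)\le L$ for every $3\le k\le m$ and every $uv\in E(G)$. Theorem. Let $\ell\ge 3$ be an integer and let $L>0$ be a constant. Then there is an integer $N$, depending only on $\ell$ and $L$, such that for every integer $n\ge N$, $$|\mathcal{G}_n(2\ell,L)|\le 2^{3(\ell+1)n^{1+1/\ell}}.$$ -/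

import Mathlib

/-- The number of `k`-cycles of `G` that contain the edge `uv`. A cycle is identified with its
set of edges, so the starting point and the direction of traversal do not matter. -/
noncomputable def cycleCount {V : Type*} (G : SimpleGraph V) (k : ℕ) (u v : V) : ℕ :=
  {C : Set (Sym2 V) | ∃ (w : V) (p : G.Walk w w),
    p.IsCycle ∧ p.length = k ∧ C = {e | e ∈ p.edges} ∧ s(u, v) ∈ C}.ncard

/-- The family `𝒢_n(m, L)` of graphs on an `n`-element labelled vertex set in which every edge
lies in at most `L` cycles of length `k`, for every `3 ≤ k ≤ m`. -/
def sparseCycleFamily (n m : ℕ) (L : ℝ) : Set (SimpleGraph (Fin n)) :=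
  {G | ∀ k : ℕ, 3 ≤ k → k ≤ m → ∀ u v : Fin n, G.Adj u v → (cycleCount G k u v : ℝ) ≤ L}

/-!
Kleitman–Winston. If `G` is in the family, removing a vertex `v` of minimum degree `d` leaves a
graph `G'` in the family whose degrees are at least `d - 1`, and `G` is recovered from `v`, `G'`
and the neighbourhood `I` of `v`. Two members of `I` joined by a walk of length at most `2ℓ - 2`
in `G'` close a short cycle through `v`, so `I` spans few pairs of the graph `H` of such walks.

Grow `ℓ - 1` layers from every vertex of a set `A` of vertices of `G'`, discarding the neighbours
that would close a short cycle with the preceding edge. The layers grow like powers of `d`, and two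
of them meet in few vertices. By Cauchy–Schwarz many pairs of layers meet once `A` has more than
about `n / d ^ (ℓ - 1)` elements, so that `H` is dense on `A`. A short sequence of vertices of
large `H`-degree therefore determines a container of about `n / d ^ (ℓ - 1)` vertices for all but
few elements of `I`, which leaves `2 ^ O(ℓ n ^ (1 / ℓ))` choices of `I` for each of the `n` removed
vertices.
-/

open Finset

theorem sq_sum_card_le_card_mul_sum_card_inter {ι α : Type*} [Fintype α] [DecidableEq α]
    (A : Finset ι) (W : ι → Finset α) :
    (∑ a ∈ A, #(W a)) ^ 2 ≤ Fintype.card α * ∑ a ∈ A, ∑ b ∈ A, #(W a ∩ W b) := by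
  let mult (x : α) : ℕ := ∑ a ∈ A, if x ∈ W a then 1 else 0
  have sum_mult : ∑ x, mult x = ∑ a ∈ A, #(W a) := by
    rw [sum_comm]
    exact sum_congr rfl fun a _ => by simp
  have sum_mult_sq : ∑ x, mult x ^ 2 = ∑ a ∈ A, ∑ b ∈ A, #(W a ∩ W b) := by
    simp only [mult, sq, sum_mul_sum]
    rw [sum_comm]
    refine sum_congr rfl fun a _ => ?_
    rw [sum_comm]
    refine sum_congr rfl fun b _ => ?_
    simp [← ite_and, ← mem_inter, inter_comm]
  rw [← sum_mult, ← sum_mult_sq]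
  exact sq_sum_le_card_mul_sum_sq

theorem sum_card_inter_le_card_add {ι α : Type*} [DecidableEq α] {A : Finset ι}
    {W : ι → Finset α} {Q : ℕ} {a : ι} (ha : a ∈ A)
    (hQ : ∀ b ∈ A, a ≠ b → #(W a ∩ W b) ≤ Q) :
    ∑ b ∈ A, #(W a ∩ W b) ≤ #(W a) + #{b ∈ A | (W a ∩ W b).Nonempty} * Q := by
  classical
  have inter_le (b) (hb : b ∈ A.erase a) :
      #(W a ∩ W b) ≤ if (W a ∩ W b).Nonempty then Q else 0 := by
    split_ifs with h
    · exact hQ b (mem_of_mem_erase hb) (ne_of_mem_erase hb).symm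
    · rw [not_nonempty_iff_eq_empty.1 h, card_empty]
  calc ∑ b ∈ A, #(W a ∩ W b)
      = #(W a) + ∑ b ∈ A.erase a, #(W a ∩ W b) := by rw [← add_sum_erase A _ ha, inter_self]
    _ ≤ #(W a) + ∑ b ∈ A.erase a, if (W a ∩ W b).Nonempty then Q else 0 := by
        gcongr with b hb
        exact inter_le b hb
    _ = #(W a) + #{b ∈ A.erase a | (W a ∩ W b).Nonempty} * Q := by
        rw [← sum_filter, sum_const, smul_eq_mul]
    _ ≤ #(W a) + #{b ∈ A | (W a ∩ W b).Nonempty} * Q := by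
        gcongr
        exact erase_subset a A

theorem exists_card_mul_sq_le_of_card_inter_le {ι α : Type*} [Fintype α] [DecidableEq α]
    {A : Finset ι} (hA : A.Nonempty) {W : ι → Finset α} {E Q : ℕ}
    (hE : ∀ a ∈ A, E ≤ #(W a)) (hQ : ∀ a ∈ A, ∀ b ∈ A, a ≠ b → #(W a ∩ W b) ≤ Q)
    (hAE : 2 * Fintype.card α ≤ #A * E) :
    ∃ a ∈ A, #A * E ^ 2 ≤
      2 * Fintype.card α * (#{b ∈ A | (W a ∩ W b).Nonempty} * Q) := by
  refine exists_le_of_sum_le hA ?_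
  rw [sum_const, smul_eq_mul, ← mul_sum]
  set total := ∑ a ∈ A, #(W a)
  set meets := ∑ a ∈ A, #{b ∈ A | (W a ∩ W b).Nonempty} * Q
  have le_total : #A * E ≤ total := card_nsmul_le_sum A _ E hE
  have pairs_le : ∑ a ∈ A, ∑ b ∈ A, #(W a ∩ W b) ≤ total + meets := by
    rw [← sum_add_distrib]
    exact sum_le_sum fun a ha => sum_card_inter_le_card_add ha (hQ a ha)
  have total_sq_le : total ^ 2 ≤ Fintype.card α * (total + meets) :=
    (sq_sum_card_le_card_mul_sum_card_inter A W).trans (Nat.mul_le_mul_left _ pairs_le)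
  have absorb : 2 * Fintype.card α * total ≤ total ^ 2 := by
    rw [sq]
    exact Nat.mul_le_mul_right _ (hAE.trans le_total)
  calc #A * (#A * E ^ 2) = (#A * E) ^ 2 := by ring
    _ ≤ total ^ 2 := Nat.pow_le_pow_left le_total 2
    _ ≤ 2 * Fintype.card α * meets := by linarith

/-! ### Small subsets and containers -/

/-- The subsets of `U` with at most `d` elements. -/
def smallSubsets {α : Type*} (U : Finset α) (d : ℕ) : Finset (Finset α) :=
  {T ∈ U.powerset | #T ≤ d}

theorem mem_smallSubsets {α : Type*} {U T : Finset α} {d : ℕ} :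
    T ∈ smallSubsets U d ↔ T ⊆ U ∧ #T ≤ d := by
  rw [smallSubsets, mem_filter, mem_powerset]

theorem card_smallSubsets_eq_sum_choose {α : Type*} (U : Finset α) (q : ℕ) :
    #(smallSubsets U q) = ∑ i ∈ range (q + 1), (#U).choose i := by
  rw [card_eq_sum_card_fiberwise (f := card) (t := range (q + 1))
    fun T hT => mem_range.2 (Nat.lt_succ_of_le (mem_smallSubsets.1 hT).2)]
  refine sum_congr rfl fun i hi => ?_
  rw [← card_powersetCard]
  congr 1
  ext T
  simp only [mem_filter, mem_smallSubsets, mem_powersetCard, mem_range] at hi ⊢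
  exact ⟨fun h => ⟨h.1.1, h.2⟩, fun h => ⟨⟨h.1, by omega⟩, h.2⟩⟩

theorem card_smallSubsets_le_pow {α : Type*} (U : Finset α) (q : ℕ) :
    #(smallSubsets U q) ≤ (#U + 1) ^ q := by
  rw [card_smallSubsets_eq_sum_choose, add_pow]
  refine sum_le_sum fun i hi => ?_
  rw [one_pow, mul_one]
  exact (Nat.choose_le_pow _ i).trans
    (Nat.le_mul_of_pos_right _ (Nat.choose_pos (Nat.lt_succ_iff.1 (mem_range.1 hi))))

theorem card_smallSubsets_mul_pow_le {α : Type*} (C : Finset α) (d : ℕ) {t : ℝ}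
    (ht₀ : 0 ≤ t) (ht₁ : t ≤ 1) :
    (#(smallSubsets C d) : ℝ) * t ^ d ≤ (1 + t) ^ #C := by
  calc (#(smallSubsets C d) : ℝ) * t ^ d
      = ∑ _J ∈ smallSubsets C d, t ^ d := by rw [sum_const, nsmul_eq_mul]
    _ ≤ ∑ J ∈ smallSubsets C d, t ^ #J :=
        sum_le_sum fun J hJ => pow_le_pow_of_le_one ht₀ ht₁ (mem_smallSubsets.1 hJ).2
    _ ≤ ∑ J ∈ C.powerset, t ^ #J :=
        sum_le_sum_of_subset_of_nonneg (filter_subset _ _) fun J _ _ => pow_nonneg ht₀ _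
    _ = (1 + t) ^ #C := by
        rw [add_comm 1 t, ← sum_pow_mul_eq_add_pow]
        simp only [one_pow, mul_one]

theorem card_smallSubsets_le_exp_mul_inv_pow {α : Type*} (C : Finset α) {d : ℕ} {t : ℝ}
    (ht₀ : 0 < t) (ht₁ : t ≤ 1) :
    (#(smallSubsets C d) : ℝ) ≤ Real.exp (t * #C) * t⁻¹ ^ d := by
  have h : (#(smallSubsets C d) : ℝ) * t ^ d ≤ Real.exp (t * #C) :=
    calc _ ≤ (1 + t) ^ #C := card_smallSubsets_mul_pow_le C d ht₀.le ht₁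
      _ ≤ Real.exp t ^ #C := by
          gcongr
          linarith [Real.add_one_le_exp t]
      _ = Real.exp (t * #C) := by rw [mul_comm, Real.exp_nat_mul]
  rwa [inv_pow, ← div_eq_mul_inv, le_div_iff₀ (by positivity)]

theorem card_smallSubsets_le_exp {α : Type*} {C : Finset α} {d k : ℕ} (hd : 0 < d) {y : ℝ}
    (hy : 0 < y) (hC : (#C : ℝ) * d ^ k ≤ y ^ (k + 1)) :
    (#(smallSubsets C d) : ℝ) ≤ Real.exp ((k + 1) * y) := by
  have hd₀ : (0 : ℝ) < d := by exact_mod_cast hd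
  rcases le_total y d with hyd | hdy
  · have card_le : (#C : ℝ) ≤ y := by
      refine le_of_mul_le_mul_right (hC.trans ?_) (pow_pos hd₀ k)
      rw [pow_succ']
      gcongr
    calc (#(smallSubsets C d) : ℝ)
        ≤ Real.exp (1 * #C) * 1⁻¹ ^ d :=
          card_smallSubsets_le_exp_mul_inv_pow C one_pos le_rfl
      _ ≤ Real.exp ((k + 1) * y) := by
          rw [inv_one, one_pow, mul_one, one_mul, Real.exp_le_exp]
          nlinarith [mul_nonneg k.cast_nonneg hy.le]
  · have exponent_le : (d / y) ^ (k + 1) * #C ≤ d := by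
      rw [div_pow, div_mul_eq_mul_div, div_le_iff₀ (by positivity)]
      calc (d : ℝ) ^ (k + 1) * #C = d * (#C * d ^ k) := by ring
        _ ≤ d * y ^ (k + 1) := by gcongr
    have ratio_pow_le : (y / d) ^ d ≤ Real.exp (y - d) := by
      calc (y / d) ^ d ≤ Real.exp (y / d - 1) ^ d := by
            gcongr
            linarith [Real.add_one_le_exp (y / d - 1)]
        _ = Real.exp (y - d) := by
            rw [← Real.exp_nat_mul]
            congr 1
            field_simp
    calc (#(smallSubsets C d) : ℝ)
        ≤ Real.exp ((d / y) ^ (k + 1) * #C) * ((d / y) ^ (k + 1))⁻¹ ^ d :=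
          card_smallSubsets_le_exp_mul_inv_pow C (by positivity)
            (pow_le_one₀ (by positivity) ((div_le_one hy).2 hdy))
      _ = Real.exp ((d / y) ^ (k + 1) * #C) * ((y / d) ^ d) ^ (k + 1) := by
          rw [← inv_pow, inv_div, pow_right_comm]
      _ ≤ Real.exp d * Real.exp (y - d) ^ (k + 1) := by gcongr
      _ ≤ Real.exp ((k + 1) * y) := by
          rw [← Real.exp_nat_mul, ← Real.exp_add, Real.exp_le_exp]
          push_cast
          nlinarith [mul_nonneg k.cast_nonneg hd₀.le]

theorem exp_two_mul_le_two_rpow_three_mul {y : ℝ} (hy : 0 ≤ y) :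
    Real.exp (2 * y) ≤ (2 : ℝ) ^ (3 * y) := by
  rw [Real.rpow_def_of_pos two_pos, Real.exp_le_exp]
  nlinarith [Real.log_two_gt_d9]

section Containers

variable {α : Type*} [DecidableEq α] {N : α → Finset α} {b R : ℝ}

theorem card_sdiff_lt_exp {A M : Finset α} {q : ℕ} (hb : 0 < b)
    (hM : (#A : ℝ) ≤ b * #(A ∩ M)) (hA : (#A : ℝ) < Real.exp ((q + 1 : ℕ) / b)) :
    (#(A \ M) : ℝ) < Real.exp (q / b) := by
  have card_split : (#(A \ M) : ℝ) + #(A ∩ M) = #A := by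
    exact_mod_cast card_sdiff_add_card_inter A M
  have inter_ge : (#A : ℝ) / b ≤ #(A ∩ M) := (div_le_iff₀' hb).2 hM
  calc (#(A \ M) : ℝ) ≤ (1 - 1 / b) * #A := by linarith [show (#A : ℝ) / b = 1 / b * #A by ring]
    _ ≤ Real.exp (-(1 / b)) * #A := by
        gcongr
        exact Real.one_sub_le_exp_neg _
    _ < Real.exp (-(1 / b)) * Real.exp ((q + 1 : ℕ) / b) := by gcongr
    _ = Real.exp (q / b) := by
        rw [← Real.exp_add]
        congr 1
        push_cast
        ring

/-- The Kleitman–Winston algorithm, with `N a` the neighbourhood of `a`. -/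
theorem exists_fingerprint_container (hb : 0 < b) {A : Finset α} {q : ℕ}
    (hN : ∀ B ⊆ A, R < #B → ∃ a ∈ B, (#B : ℝ) ≤ b * #(B ∩ N a))
    (hA : (#A : ℝ) < Real.exp (q / b)) :
    ∃ C : Finset α → Finset α, (∀ T, (#(C T) : ℝ) ≤ R) ∧
      ∀ I ⊆ A, ∃ T ⊆ I, #T ≤ q ∧ I ⊆ T ∪ T.biUnion N ∪ C T := by
  induction A using Finset.strongInduction generalizing q with
  | H A ih =>
  rcases le_or_gt (#A : ℝ) R with small | large
  · exact ⟨fun _ => A, fun _ => small, fun I hI =>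
      ⟨∅, empty_subset I, by simp, hI.trans subset_union_right⟩⟩
  obtain ⟨a, ha, haN⟩ := hN A subset_rfl large
  obtain ⟨q, rfl⟩ : ∃ p, q = p + 1 := by
    refine Nat.exists_eq_succ_of_ne_zero fun hq => (card_pos.2 ⟨a, ha⟩).ne' ?_
    simpa [hq] using hA
  have erase_ssub : A.erase a ⊂ A := erase_ssubset ha
  have sdiff_ssub : (A \ N a).erase a ⊂ A :=
    (erase_subset_erase a sdiff_subset).trans_ssubset erase_ssub
  obtain ⟨C₀, hC₀, hI₀⟩ := ih _ erase_ssub (q := q + 1)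
    (fun B hB => hN B (hB.trans erase_ssub.subset))
    ((Nat.cast_le.2 (card_le_card erase_ssub.subset)).trans_lt hA)
  obtain ⟨C₁, hC₁, hI₁⟩ := ih _ sdiff_ssub (q := q)
    (fun B hB => hN B (hB.trans sdiff_ssub.subset))
    ((Nat.cast_le.2 (card_le_card (erase_subset a _))).trans_lt (card_sdiff_lt_exp hb haN hA))
  refine ⟨fun T => if a ∈ T then C₁ (T.erase a) else C₀ T, fun T => ?_, fun I hI => ?_⟩
  · dsimp only
    split_ifs
    exacts [hC₁ _, hC₀ _]
  by_cases haI : a ∈ I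
  · obtain ⟨T, hTI, hTq, hIT⟩ := hI₁ ((I \ N a).erase a)
      (erase_subset_erase a (sdiff_subset_sdiff hI subset_rfl))
    have haT : a ∉ T := fun h => notMem_erase a _ (hTI h)
    refine ⟨insert a T, insert_subset haI (hTI.trans ((erase_subset a _).trans sdiff_subset)),
      (card_insert_le a T).trans (Nat.succ_le_succ hTq), fun x hx => ?_⟩
    have cover : x ≠ a → x ∉ N a → x ∈ T ∪ T.biUnion N ∪ C₁ T := fun hxa hxN =>
      hIT (mem_erase.2 ⟨hxa, mem_sdiff.2 ⟨hx, hxN⟩⟩)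
    simp only [mem_insert_self, if_true, erase_insert haT, biUnion_insert, mem_union,
      mem_insert] at cover ⊢
    tauto
  · obtain ⟨T, hTI, hTq, hIT⟩ := hI₀ I (subset_erase.2 ⟨hI, haI⟩)
    refine ⟨T, hTI, hTq, ?_⟩
    dsimp only
    rwa [if_neg fun h => haI (hTI h)]

/-- The `d`-element subsets of `U` in which every element `a` has at most `K` members of its
neighbourhood `N a`. -/
def sparseSubsets (N : α → Finset α) (K : ℕ) (U : Finset α) (d : ℕ) : Finset (Finset α) :=
  {I ∈ U.powersetCard d | ∀ a ∈ I, #(I ∩ N a) ≤ K}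

theorem mem_sparseSubsets {K : ℕ} {U I : Finset α} {d : ℕ} :
    I ∈ sparseSubsets N K U d ↔ I ⊆ U ∧ #I = d ∧ ∀ a ∈ I, #(I ∩ N a) ≤ K := by
  rw [sparseSubsets, mem_filter, mem_powersetCard, and_assoc]

theorem card_sparseSubsets_le_pow (K : ℕ) (U : Finset α) (d : ℕ) :
    #(sparseSubsets N K U d) ≤ (#U + 1) ^ d := by
  refine (card_le_card fun I hI => ?_).trans (card_smallSubsets_le_pow U d)
  obtain ⟨hIU, hId, -⟩ := mem_sparseSubsets.1 hI
  exact mem_smallSubsets.2 ⟨hIU, hId.le⟩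

theorem card_sparseSubsets_le_of_containers (hb : 0 < b) {U : Finset α}
    (hN : ∀ B ⊆ U, R < #B → ∃ a ∈ B, (#B : ℝ) ≤ b * #(B ∩ N a)) {q : ℕ}
    (hU : (#U : ℝ) < Real.exp (q / b)) {d K : ℕ} {P : ℝ}
    (hP : ∀ C : Finset α, (#C : ℝ) ≤ R → (#(smallSubsets C d) : ℝ) ≤ P) :
    (#(sparseSubsets N K U d) : ℝ) ≤ (#U + 1) ^ ((K + 1) * q) * P := by
  obtain ⟨C, hCR, hC⟩ := exists_fingerprint_container hb hN hU
  set codes := smallSubsets U q ×ˢ smallSubsets U (q * K)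
  have encode : sparseSubsets N K U d ⊆
      codes.biUnion fun p => (smallSubsets (C p.1) d).image fun Y => p.1 ∪ p.2 ∪ Y := by
    intro I hI
    obtain ⟨hIU, hId, hIK⟩ := mem_sparseSubsets.1 hI
    obtain ⟨T, hTI, hTq, hIT⟩ := hC I hIU
    have card_nbrs : #(I ∩ T.biUnion N) ≤ q * K := by
      rw [inter_biUnion]
      exact (card_biUnion_le_card_mul T _ K fun a ha => hIK a (hTI ha)).trans
        (Nat.mul_le_mul_right K hTq)
    refine mem_biUnion.2 ⟨(T, I ∩ T.biUnion N), mem_product.2 ⟨?_, ?_⟩,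
      mem_image.2 ⟨I ∩ C T, ?_, ?_⟩⟩
    · exact mem_smallSubsets.2 ⟨hTI.trans hIU, hTq⟩
    · exact mem_smallSubsets.2 ⟨inter_subset_left.trans hIU, card_nbrs⟩
    · exact mem_smallSubsets.2 ⟨inter_subset_right, hId ▸ card_le_card inter_subset_left⟩
    · calc T ∪ I ∩ T.biUnion N ∪ I ∩ C T = I ∩ (T ∪ T.biUnion N ∪ C T) := by
            rw [inter_union_distrib_left, inter_union_distrib_left, inter_eq_right.2 hTI]
        _ = I := inter_eq_left.2 hIT
  have card_codes : #codes ≤ (#U + 1) ^ ((K + 1) * q) :=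
    calc #codes = #(smallSubsets U q) * #(smallSubsets U (q * K)) := card_product _ _
      _ ≤ (#U + 1) ^ q * (#U + 1) ^ (q * K) := by
          gcongr <;> exact card_smallSubsets_le_pow U _
      _ = (#U + 1) ^ ((K + 1) * q) := by ring
  have hP₀ : 0 ≤ P := (Nat.cast_nonneg _).trans (hP (C ∅) (hCR ∅))
  calc (#(sparseSubsets N K U d) : ℝ)
      ≤ ∑ p ∈ codes, (#((smallSubsets (C p.1) d).image fun Y => p.1 ∪ p.2 ∪ Y) : ℝ) := by
        exact_mod_cast (card_le_card encode).trans card_biUnion_le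
    _ ≤ #codes * P := by
        rw [← nsmul_eq_mul]
        exact sum_le_card_nsmul _ _ P fun p _ =>
          (Nat.cast_le.2 card_image_le).trans (hP _ (hCR p.1))
    _ ≤ (#U + 1) ^ ((K + 1) * q) * P := by
        gcongr
        exact_mod_cast card_codes

theorem card_sparseSubsets_le_two_rpow (K : ℕ) {U : Finset α} {Λ : ℝ}
    (hU : (#U : ℝ) + 1 ≤ 2 ^ Λ) (d : ℕ) :
    (#(sparseSubsets N K U d) : ℝ) ≤ 2 ^ (Λ * d) :=
  calc (#(sparseSubsets N K U d) : ℝ) ≤ (#U + 1) ^ d := by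
        exact_mod_cast card_sparseSubsets_le_pow K U d
    _ ≤ (2 ^ Λ) ^ d := by gcongr
    _ = 2 ^ (Λ * d) := (Real.rpow_mul_natCast two_pos.le _ _).symm

theorem card_sparseSubsets_le_of_supersaturated {U : Finset α} {Λ x : ℝ} {d k K : ℕ}
    (hb : 1 ≤ b) (hΛ : 1 ≤ Λ) (hU : (#U : ℝ) + 1 ≤ 2 ^ Λ) (hd : 0 < d)
    (hN : ∀ B ⊆ U, (2 * x) ^ (k + 1) / d ^ k < #B → ∃ a ∈ B, (#B : ℝ) ≤ b * #(B ∩ N a))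
    (hΛx : (K + 1) * b * Λ ^ 2 ≤ x) :
    (#(sparseSubsets N K U d) : ℝ) ≤ 2 ^ ((3 * k + 5) * x) := by
  have hx₀ : 0 < x := lt_of_lt_of_le (by positivity) hΛx
  set q := ⌈b * Λ⌉₊
  have hU_lt : (#U : ℝ) < Real.exp (q / b) :=
    calc (#U : ℝ) < 2 ^ Λ := by linarith
      _ ≤ Real.exp Λ := by
          rw [Real.rpow_def_of_pos two_pos, Real.exp_le_exp]
          nlinarith [Real.log_two_lt_d9]
      _ ≤ Real.exp (q / b) := by
          rw [Real.exp_le_exp, le_div_iff₀' (by linarith)]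
          exact Nat.le_ceil _
  have small_le (C : Finset α) (hC : (#C : ℝ) ≤ (2 * x) ^ (k + 1) / d ^ k) :
      (#(smallSubsets C d) : ℝ) ≤ 2 ^ (3 * ((k + 1) * x)) :=
    calc _ ≤ Real.exp ((k + 1) * (2 * x)) :=
          card_smallSubsets_le_exp hd (by positivity) ((le_div_iff₀ (by positivity)).1 hC)
      _ = Real.exp (2 * ((k + 1) * x)) := by ring_nf
      _ ≤ 2 ^ (3 * ((k + 1) * x)) := exp_two_mul_le_two_rpow_three_mul (by positivity)
  have exponent_le : Λ * ((K + 1) * q : ℕ) ≤ 2 * x := by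
    have hq : (q : ℝ) ≤ 2 * (b * Λ) :=
      (Nat.ceil_lt_add_one (by positivity)).le.trans (by nlinarith)
    push_cast
    calc Λ * ((K + 1) * q) ≤ Λ * ((K + 1) * (2 * (b * Λ))) := by gcongr
      _ = 2 * ((K + 1) * b * Λ ^ 2) := by ring
      _ ≤ 2 * x := by gcongr
  calc (#(sparseSubsets N K U d) : ℝ)
      ≤ (#U + 1) ^ ((K + 1) * q) * 2 ^ (3 * ((k + 1) * x)) :=
        card_sparseSubsets_le_of_containers (by linarith) hN hU_lt small_le
    _ ≤ (2 ^ Λ) ^ ((K + 1) * q) * 2 ^ (3 * ((k + 1) * x)) := by gcongr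
    _ = 2 ^ (Λ * ((K + 1) * q : ℕ) + 3 * ((k + 1) * x)) := by
        rw [← Real.rpow_mul_natCast two_pos.le, ← Real.rpow_add two_pos]
    _ ≤ 2 ^ ((3 * k + 5) * x) :=
        Real.rpow_le_rpow_of_exponent_le one_le_two (by linarith)

end Containers

/-! ### Short returns and branches -/

section Branches
open SimpleGraph
open scoped Classical

variable {V : Type*} [Fintype V] {G : SimpleGraph V} {m K : ℕ}

/-- The neighbours of `y` that can be reached from `z` by a walk of length at most `m` avoiding
`y`. When `yz` is an edge, those other than `z` itself close a short cycle through `yz`. -/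
noncomputable def shortReturns (G : SimpleGraph V) (m : ℕ) (y z : V) : Finset V :=
  {x | G.Adj y x ∧ ∃ w : G.Walk z x, w.length ≤ m ∧ y ∉ w.support}

theorem mem_shortReturns {x y z : V} :
    x ∈ shortReturns G m y z ↔ G.Adj y x ∧ ∃ w : G.Walk z x, w.length ≤ m ∧ y ∉ w.support := by
  rw [shortReturns, mem_filter_univ]

theorem exists_isCycle_of_mem_shortReturns {x y z : V} (hyz : G.Adj y z) (hxz : x ≠ z)
    (hx : x ∈ shortReturns G m y z) :
    ∃ p : G.Walk y y, p.IsCycle ∧ p.length ∈ Icc 3 (m + 2) ∧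
      ∀ x', s(y, x') ∈ p.edges ↔ x' = z ∨ x' = x := by
  obtain ⟨hyx, w, hw, hy⟩ := mem_shortReturns.1 hx
  have hyp : y ∉ w.bypass.support := fun h => hy (w.support_bypass_subset_support h)
  have mem_edges (x') : s(y, x') ∈ (Walk.cons hyz (w.bypass.concat hyx.symm)).edges ↔
      x' = z ∨ x' = x := by
    have not_mem : s(y, x') ∉ w.bypass.edges := fun h =>
      hyp (Walk.fst_mem_support_of_mem_edges _ h)
    rw [Walk.edges_cons, Walk.edges_concat, List.mem_cons, List.concat_eq_append,
      List.mem_append, List.mem_singleton, Sym2.eq_swap (a := x), Sym2.congr_right,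
      Sym2.congr_right, or_iff_right not_mem]
  refine ⟨Walk.cons hyz (w.bypass.concat hyx.symm), ?_, ?_, mem_edges⟩
  · rw [Walk.cons_isCycle_iff, Walk.concat_isPath_iff]
    refine ⟨⟨w.bypass_isPath, hyp⟩, fun h => ?_⟩
    rw [Walk.edges_concat, List.concat_eq_append, List.mem_append, List.mem_singleton,
      Sym2.eq_swap (a := x), Sym2.congr_right] at h
    exact h.elim (fun h => hyp (Walk.fst_mem_support_of_mem_edges _ h)) hxz.symm
  · have : w.bypass.length ≠ 0 := fun h => hxz (Walk.eq_of_length_eq_zero h).symm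
    have := w.length_bypass_le_length
    simp only [Walk.length_cons, Walk.length_concat, mem_Icc]
    omega

theorem card_shortReturns_le {y z : V} (hyz : G.Adj y z) :
    #(shortReturns G m y z) ≤ ∑ k ∈ Icc 3 (m + 2), cycleCount G k y z + 1 := by
  choose! p hcycle hlen hedges using fun x (hx : x ∈ (shortReturns G m y z).erase z) =>
    exists_isCycle_of_mem_shortReturns hyz (ne_of_mem_erase hx) (mem_of_mem_erase hx)
  have maps : ∀ x ∈ (shortReturns G m y z).erase z, {e | e ∈ (p x).edges} ∈
      ⋃ k ∈ Icc 3 (m + 2), {C : Set (Sym2 V) | ∃ (w : V) (p : G.Walk w w),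
        p.IsCycle ∧ p.length = k ∧ C = {e | e ∈ p.edges} ∧ s(y, z) ∈ C} := fun x hx =>
    Set.mem_biUnion (hlen x hx)
      ⟨y, p x, hcycle x hx, rfl, rfl, (hedges x hx z).2 (Or.inl rfl)⟩
  have inj : Set.InjOn (fun x => {e | e ∈ (p x).edges})
      ((shortReturns G m y z).erase z : Set V) := by
    intro x hx x' hx' hxx'
    have hxp : s(y, x) ∈ {e | e ∈ (p x').edges} :=
      hxx'.subset ((hedges x hx x).2 (Or.inr rfl))
    exact ((hedges x' hx' x).1 hxp).resolve_left (ne_of_mem_erase hx)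
  have card_erase_le : #((shortReturns G m y z).erase z) ≤
      ∑ k ∈ Icc 3 (m + 2), cycleCount G k y z := by
    rw [← Set.ncard_coe_finset]
    exact (Set.ncard_le_ncard_of_injOn _ maps inj (Set.toFinite _)).trans
      (Finset.set_ncard_biUnion_le _ _)
  have := pred_card_le_card_erase (s := shortReturns G m y z) (a := z)
  omega

/-- Every edge `yz` has at most `K` short returns to `y`: the form in which the bound on short
cycles is used. -/
def FewReturns (G : SimpleGraph V) (m K : ℕ) : Prop :=
  ∀ y z, G.Adj y z → #(shortReturns G m y z) ≤ K

theorem FewReturns.mono {G' : SimpleGraph V} (h : FewReturns G m K) (hle : G' ≤ G) :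
    FewReturns G' m K := by
  intro y z hyz
  refine (card_le_card fun x hx => ?_).trans (h y z (hle hyz))
  obtain ⟨hyx, w, hw, hy⟩ := mem_shortReturns.1 hx
  exact mem_shortReturns.2 ⟨hle hyx, w.mapLe hle, by simpa using hw, by simpa using hy⟩

theorem fewReturns_of_mem_sparseCycleFamily {n : ℕ} {L : ℝ} {G : SimpleGraph (Fin n)}
    (hG : G ∈ sparseCycleFamily n (m + 2) L) : FewReturns G m (m * ⌊L⌋₊ + 1) := by
  intro y z hyz
  refine (card_shortReturns_le hyz).trans (Nat.succ_le_succ ?_)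
  calc ∑ k ∈ Icc 3 (m + 2), cycleCount G k y z
      ≤ #(Icc 3 (m + 2)) • ⌊L⌋₊ := sum_le_card_nsmul _ _ _ fun k hk =>
        Nat.le_floor (hG k (mem_Icc.1 hk).1 (mem_Icc.1 hk).2 y z hyz)
    _ = m * ⌊L⌋₊ := by
        rw [Nat.card_Icc, smul_eq_mul]
        rfl

/-- A walk from the tip `x` to the root `a` each of whose vertices is chosen, as seen from the
root, in the set `S` of its predecessor and off the short returns of the preceding edge. -/
structure IsBranch (m : ℕ) (S : V → Finset V) {x a : V} (p : G.Walk x a) : Prop where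
  fst_mem : ∀ e ∈ p.darts, e.fst ∈ S e.snd
  isChain : p.darts.IsChain fun e f => e.fst ∉ shortReturns G m e.snd f.snd

variable {S : V → Finset V}

theorem isBranch_nil {a : V} : IsBranch m S (Walk.nil : G.Walk a a) :=
  ⟨by simp, by simp⟩

theorem isBranch_cons_nil {x a : V} {h : G.Adj x a} :
    IsBranch m S (Walk.cons h Walk.nil) ↔ x ∈ S a :=
  ⟨fun hp => hp.fst_mem ⟨(x, a), h⟩ (by simp), fun hx => ⟨by simpa, by simp⟩⟩

theorem isBranch_cons_cons {x y z a : V} {h : G.Adj x y} {h' : G.Adj y z} {p : G.Walk z a} :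
    IsBranch m S (Walk.cons h (Walk.cons h' p)) ↔
      x ∈ S y ∧ x ∉ shortReturns G m y z ∧ IsBranch m S (Walk.cons h' p) := by
  constructor
  · rintro ⟨hS, hc⟩
    simp only [Walk.darts_cons, List.forall_mem_cons, List.isChain_cons_cons] at hS hc
    exact ⟨hS.1, hc.1, by simpa using hS.2, by simpa using hc.2⟩
  · rintro ⟨hx, hr, hS, hc⟩
    simp only [Walk.darts_cons, List.forall_mem_cons] at hS hc
    exact ⟨by simpa using ⟨hx, hS⟩, by simpa using ⟨hr, hc⟩⟩

theorem IsBranch.fst_mem_of_cons {x y a : V} {h : G.Adj x y} {p : G.Walk y a}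
    (hp : IsBranch m S (Walk.cons h p)) : x ∈ S y :=
  hp.fst_mem ⟨(x, y), h⟩ (by simp)

theorem IsBranch.of_cons {x y a : V} {h : G.Adj x y} {p : G.Walk y a}
    (hp : IsBranch m S (Walk.cons h p)) : IsBranch m S p := by
  cases p with
  | nil => exact isBranch_nil
  | cons h' p => exact (isBranch_cons_cons.1 hp).2.2

theorem IsBranch.isPath {x a : V} {p : G.Walk x a} (hp : IsBranch m S p) (hm : p.length ≤ m) :
    p.IsPath := by
  induction p with
  | nil => exact Walk.IsPath.nil
  | @cons x y a h p ih =>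
  rw [Walk.length_cons] at hm
  have tail_isPath : p.IsPath := ih hp.of_cons (by omega)
  refine tail_isPath.cons fun hx => ?_
  cases p with
  | nil => exact h.ne (List.mem_singleton.1 hx)
  | @cons _ z _ h' p =>
  rw [Walk.length_cons] at hm
  have hxp : x ∈ p.support := (List.mem_cons.1 hx).resolve_left h.ne
  have hyp : y ∉ p.support := ((Walk.cons_isPath_iff h' p).1 tail_isPath).2
  refine (isBranch_cons_cons.1 hp).2.1 (mem_shortReturns.2 ⟨h.symm, p.takeUntil x hxp, ?_, ?_⟩)
  · exact (p.length_takeUntil_le_length hxp).trans (by omega)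
  · exact fun hy => hyp (p.support_takeUntil_subset_support hxp hy)

theorem IsBranch.eq_of_adj_of_mem_support {x y z b : V} {h : G.Adj x z} {q : G.Walk z b}
    (hq : IsBranch m S (Walk.cons h q)) (hm : q.length ≤ m) (hxy : G.Adj x y)
    (hy : y ∈ q.support) : y = z := by
  by_contra hyz
  cases q with
  | nil => exact hyz (List.mem_singleton.1 hy)
  | @cons _ w _ h' q =>
  have hzq : z ∉ q.support :=
    ((Walk.cons_isPath_iff h' q).1 (hq.of_cons.isPath hm)).2
  have hyq : y ∈ q.support := (List.mem_cons.1 hy).resolve_left hyz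
  refine (isBranch_cons_cons.1 hq).2.1
    (mem_shortReturns.2 ⟨h.symm, (q.takeUntil y hyq).concat hxy.symm, ?_, ?_⟩)
  · have := q.length_takeUntil_le_length hyq
    rw [Walk.length_cons] at hm
    rw [Walk.length_concat]
    omega
  · rw [Walk.support_concat, List.mem_append, List.mem_singleton]
    exact not_or.2 ⟨fun hz => hzq (q.support_takeUntil_subset_support hyq hz), h.ne'⟩

theorem IsBranch.unique {x a : V} {p q : G.Walk x a} (hp : IsBranch m S p) (hq : IsBranch m S q)
    (hm : p.length + q.length ≤ m) : p = q := by
  induction p with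
  | nil => exact (Walk.isPath_iff_nil.1 (hq.isPath (by simpa using hm))).eq_nil.symm
  | @cons x y a h p ih =>
  have hpath : (Walk.cons h p).IsPath := hp.isPath (by omega)
  cases q with
  | nil => exact absurd hpath (by simp)
  | @cons _ y' _ h' q =>
  simp only [Walk.length_cons] at hm
  by_cases hyq : y ∈ q.support
  · obtain rfl : y = y' := hq.eq_of_adj_of_mem_support (by omega) h hyq
    rw [ih hp.of_cons hq.of_cons (by omega)]
  cases p with
  | nil => exact absurd q.end_mem_support hyq
  | @cons _ z _ h₁ p =>
  have hyp : y ∉ p.support := ((Walk.cons_isPath_iff h₁ p).1 hpath.of_cons).2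
  refine absurd (mem_shortReturns.2 ⟨h.symm, p.append (Walk.cons h' q).reverse, ?_, ?_⟩)
    (isBranch_cons_cons.1 hp).2.1
  · simp only [Walk.length_cons, Walk.length_append, Walk.length_reverse] at hm ⊢
    omega
  · simp only [Walk.mem_support_append_iff, Walk.support_reverse, List.mem_reverse,
      Walk.support_cons, List.mem_cons, not_or]
    exact ⟨hyp, h.ne', hyq⟩

/-- The tips of the branches of length `j` with root `a`. -/
noncomputable def layer (G : SimpleGraph V) (m : ℕ) (S : V → Finset V) (a : V) (j : ℕ) :
    Finset V :=
  {x | ∃ p : G.Walk x a, IsBranch m S p ∧ p.length = j}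

theorem mem_layer {a x : V} {j : ℕ} :
    x ∈ layer G m S a j ↔ ∃ p : G.Walk x a, IsBranch m S p ∧ p.length = j := by
  rw [layer, mem_filter_univ]

theorem layer_zero (a : V) : layer G m S a 0 = {a} := by
  ext x
  rw [mem_layer, mem_singleton]
  constructor
  · rintro ⟨p, -, hp⟩
    exact Walk.eq_of_length_eq_zero hp
  · rintro rfl
    exact ⟨Walk.nil, isBranch_nil, rfl⟩

theorem exists_cons_of_mem_layer_succ {a x : V} {j : ℕ} (hx : x ∈ layer G m S a (j + 1)) :
    ∃ (y : V) (h : G.Adj x y) (p : G.Walk y a), IsBranch m S (Walk.cons h p) ∧ p.length = j := by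
  obtain ⟨p, hp, hlen⟩ := mem_layer.1 hx
  cases p with
  | nil => simp at hlen
  | @cons _ y _ h p => exact ⟨y, h, p, hp, Nat.succ.inj hlen⟩

theorem layer_succ_subset_biUnion (a : V) (j : ℕ) :
    layer G m S a (j + 1) ⊆ (layer G m S a j).biUnion S := by
  intro x hx
  obtain ⟨y, h, p, hp, hlen⟩ := exists_cons_of_mem_layer_succ hx
  exact mem_biUnion.2 ⟨y, mem_layer.2 ⟨p, hp.of_cons, hlen⟩, hp.fst_mem_of_cons⟩

theorem layer_subset {U : Finset V} (hU : G.support ⊆ U) {a : V} (ha : a ∈ U) (j : ℕ) :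
    layer G m S a j ⊆ U := by
  intro x hx
  obtain ⟨p, -, -⟩ := mem_layer.1 hx
  cases p with
  | nil => exact ha
  | cons h p => exact hU (G.mem_support.2 ⟨_, h⟩)

theorem card_layer_le {D : ℕ} (hD : ∀ u, #(S u) ≤ D) (a : V) (j : ℕ) :
    #(layer G m S a j) ≤ D ^ j := by
  induction j with
  | zero => rw [layer_zero, card_singleton, pow_zero]
  | succ j ih =>
    calc #(layer G m S a (j + 1)) ≤ #(layer G m S a j) * D :=
          (card_le_card (layer_succ_subset_biUnion a j)).trans
            (card_biUnion_le_card_mul _ _ D fun y _ => hD y)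
      _ ≤ D ^ (j + 1) := by
          rw [pow_succ]
          gcongr

theorem IsBranch.exists_extensions (hS : ∀ u, ∀ v ∈ S u, G.Adj u v) (hG : FewReturns G m K)
    {y a : V} {p : G.Walk y a} (hp : IsBranch m S p) :
    ∃ T : Finset V, #(S y) - K ≤ #T ∧ ∀ x ∈ T, ∃ h : G.Adj x y, IsBranch m S (Walk.cons h p) := by
  cases p with
  | nil =>
    exact ⟨S y, Nat.sub_le _ _, fun x hx => ⟨(hS y x hx).symm, isBranch_cons_nil.2 hx⟩⟩
  | @cons _ z _ h p =>
    refine ⟨S y \ shortReturns G m y z, ?_, fun x hx => ?_⟩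
    · exact (Nat.sub_le_sub_left (hG y z h) _).trans (le_card_sdiff _ _)
    · obtain ⟨hxS, hxr⟩ := mem_sdiff.1 hx
      exact ⟨(hS y x hxS).symm, isBranch_cons_cons.2 ⟨hxS, hxr, hp⟩⟩

theorem card_layer_mul_le (hS : ∀ u, ∀ v ∈ S u, G.Adj u v) (hG : FewReturns G m K)
    {D j : ℕ} {a : V} (hD : ∀ y ∈ layer G m S a j, D ≤ #(S y)) (hj : 2 * (j + 1) ≤ m) :
    #(layer G m S a j) * (D - K) ≤ #(layer G m S a (j + 1)) := by
  let IsChild (y x : V) : Prop :=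
    ∃ (h : G.Adj x y) (p : G.Walk y a), IsBranch m S (Walk.cons h p) ∧ p.length = j
  rw [← mul_one #(layer G m S a (j + 1))]
  refine card_mul_le_card_mul IsChild (fun y hy => ?_) fun x _ => ?_
  · obtain ⟨p, hp, hlen⟩ := mem_layer.1 hy
    obtain ⟨T, hT, hext⟩ := hp.exists_extensions hS hG
    refine (Nat.sub_le_sub_right (hD y hy) K).trans (hT.trans (card_le_card fun x hx => ?_))
    obtain ⟨h, hhp⟩ := hext x hx
    exact (mem_bipartiteAbove IsChild).2
      ⟨mem_layer.2 ⟨_, hhp, congrArg Nat.succ hlen⟩, h, p, hhp, hlen⟩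
  · refine card_le_one.2 fun y hy y' hy' => ?_
    obtain ⟨h, p, hp, hlen⟩ := ((mem_bipartiteBelow IsChild).1 hy).2
    obtain ⟨h', p', hp', hlen'⟩ := ((mem_bipartiteBelow IsChild).1 hy').2
    have same_walk := hp.unique hp' (by simp only [Walk.length_cons]; omega)
    exact (Walk.cons.inj same_walk).1

theorem pow_le_card_layer (hS : ∀ u, ∀ v ∈ S u, G.Adj u v) (hG : FewReturns G m K)
    {U : Finset V} (hU : G.support ⊆ U) {D : ℕ} (hD : ∀ u ∈ U, D ≤ #(S u)) {a : V} (ha : a ∈ U)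
    {j : ℕ} (hj : 2 * j ≤ m) : (D - K) ^ j ≤ #(layer G m S a j) := by
  induction j with
  | zero => rw [layer_zero, card_singleton, pow_zero]
  | succ j ih =>
    calc (D - K) ^ (j + 1) ≤ #(layer G m S a j) * (D - K) := by
          rw [pow_succ]
          gcongr
          exact ih (by omega)
      _ ≤ #(layer G m S a (j + 1)) :=
          card_layer_mul_le hS hG (fun y hy => hD y (layer_subset hU ha j hy)) hj

/-- The vertices of `S y` from which a branch of length `j` leads to `b` without meeting `y`. -/
noncomputable def avoidingTips (G : SimpleGraph V) (m : ℕ) (S : V → Finset V) (b : V) (j : ℕ)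
    (y : V) : Finset V :=
  {x ∈ S y | ∃ q : G.Walk x b, IsBranch m S q ∧ q.length = j ∧ y ∉ q.support}

theorem card_avoidingTips_le (hS : ∀ u, ∀ v ∈ S u, G.Adj u v) (hG : FewReturns G m K) {j : ℕ}
    (hj : 2 * j ≤ m) (b y : V) : #(avoidingTips G m S b j y) ≤ K := by
  rcases (avoidingTips G m S b j y).eq_empty_or_nonempty with hempty | ⟨z, hz⟩
  · simp [hempty]
  obtain ⟨hzS, r, -, hr, hyr⟩ := mem_filter.1 hz
  refine (card_le_card fun x hx => ?_).trans (hG y z (hS y z hzS))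
  obtain ⟨hxS, q, -, hq, hyq⟩ := mem_filter.1 hx
  refine mem_shortReturns.2 ⟨hS y x hxS, r.append q.reverse, ?_, ?_⟩
  · rw [Walk.length_append, Walk.length_reverse]
    omega
  · rw [Walk.mem_support_append_iff, Walk.support_reverse, List.mem_reverse]
    exact not_or.2 ⟨hyr, hyq⟩

theorem layer_inter_layer_succ_subset {a b : V} {j : ℕ} (hj : j ≤ m) :
    layer G m S a (j + 1) ∩ layer G m S b (j + 1) ⊆
      (layer G m S a j ∩ layer G m S b j).biUnion S ∪
        (layer G m S a j).biUnion (avoidingTips G m S b (j + 1)) := by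
  intro x hx
  obtain ⟨hxa, hxb⟩ := mem_inter.1 hx
  obtain ⟨y, h, p, hp, hlen⟩ := exists_cons_of_mem_layer_succ hxa
  obtain ⟨y', h', q, hq, hlen'⟩ := exists_cons_of_mem_layer_succ hxb
  have hy : y ∈ layer G m S a j := mem_layer.2 ⟨p, hp.of_cons, hlen⟩
  by_cases hyq : y ∈ q.support
  · obtain rfl : y = y' := hq.eq_of_adj_of_mem_support (hlen'.trans_le hj) h hyq
    have hyb : y ∈ layer G m S b j := mem_layer.2 ⟨q, hq.of_cons, hlen'⟩
    exact mem_union_left _ (mem_biUnion.2 ⟨y, mem_inter.2 ⟨hy, hyb⟩, hp.fst_mem_of_cons⟩)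
  · refine mem_union_right _ (mem_biUnion.2 ⟨y, hy, mem_filter.2
      ⟨hp.fst_mem_of_cons, Walk.cons h' q, hq, congrArg Nat.succ hlen', ?_⟩⟩)
    rw [Walk.support_cons, List.mem_cons]
    exact not_or.2 ⟨h.ne', hyq⟩

theorem card_layer_inter_layer_mul_le (hS : ∀ u, ∀ v ∈ S u, G.Adj u v) (hG : FewReturns G m K)
    {D : ℕ} (hD : ∀ u, #(S u) ≤ D) {a b : V} (hab : a ≠ b) {j : ℕ} (hj : 2 * j ≤ m) :
    #(layer G m S a j ∩ layer G m S b j) * D ≤ j * K * D ^ j := by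
  induction j with
  | zero => simp [layer_zero, hab]
  | succ j ih =>
    have card_le : #(layer G m S a (j + 1) ∩ layer G m S b (j + 1)) ≤
        #(layer G m S a j ∩ layer G m S b j) * D + D ^ j * K :=
      calc _ ≤ _ := (card_le_card (layer_inter_layer_succ_subset (by omega))).trans
            (card_union_le _ _)
        _ ≤ #(layer G m S a j ∩ layer G m S b j) * D + #(layer G m S a j) * K :=
          Nat.add_le_add (card_biUnion_le_card_mul _ _ D fun y _ => hD y)
            (card_biUnion_le_card_mul _ _ K fun y _ => card_avoidingTips_le hS hG hj b y)
        _ ≤ #(layer G m S a j ∩ layer G m S b j) * D + D ^ j * K := by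
          gcongr
          exact card_layer_le hD a j
    calc #(layer G m S a (j + 1) ∩ layer G m S b (j + 1)) * D
        ≤ (#(layer G m S a j ∩ layer G m S b j) * D + D ^ j * K) * D := by gcongr
      _ ≤ (j * K * D ^ j + D ^ j * K) * D :=
          Nat.mul_le_mul_right D (Nat.add_le_add_right (ih (by omega)) _)
      _ = (j + 1) * K * D ^ (j + 1) := by ring

/-- The vertices joined to `a` by a walk of length at most `m`. -/
noncomputable def walkBall (G : SimpleGraph V) (m : ℕ) (a : V) : Finset V :=
  {x | ∃ w : G.Walk a x, w.length ≤ m}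

theorem mem_walkBall {a x : V} : x ∈ walkBall G m a ↔ ∃ w : G.Walk a x, w.length ≤ m := by
  rw [walkBall, mem_filter_univ]

theorem mem_walkBall_of_layer_inter_layer_nonempty {a b : V} {j : ℕ} (hj : 2 * j ≤ m)
    (h : (layer G m S a j ∩ layer G m S b j).Nonempty) : b ∈ walkBall G m a := by
  obtain ⟨x, hx⟩ := h
  obtain ⟨⟨p, -, hp⟩, ⟨q, -, hq⟩⟩ := (mem_inter.1 hx).imp mem_layer.1 mem_layer.1
  refine mem_walkBall.2 ⟨p.reverse.append q, ?_⟩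
  rw [Walk.length_append, Walk.length_reverse]
  omega

theorem exists_card_mul_le_card_inter_walkBall {U A : Finset V} {k D : ℕ}
    (hG : FewReturns G (2 * k) K) (hU : G.support ⊆ U) (hD : ∀ u ∈ U, D ≤ G.degree u)
    (hAU : A ⊆ U) (hA : A.Nonempty) (hDA : 2 * Fintype.card V ≤ #A * (D - K) ^ k) :
    ∃ a ∈ A, #A * ((D - K) ^ k) ^ 2 * D ≤
      2 * Fintype.card V * (#(A ∩ walkBall G (2 * k) a) * (k * K * D ^ k)) := by
  choose S hS hcard using fun u =>
    exists_subset_card_eq ((min_le_right D _).trans_eq (G.card_neighborFinset_eq_degree u).symm)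
  have adj (u) (v) (hv : v ∈ S u) : G.Adj u v := (G.mem_neighborFinset u v).1 (hS u hv)
  have card_le (u) : #(S u) ≤ D := (hcard u).trans_le (min_le_left _ _)
  have le_card (u) (hu : u ∈ U) : D ≤ #(S u) := (le_min le_rfl (hD u hu)).trans_eq (hcard u).symm
  rcases D.eq_zero_or_pos with rfl | hD₀
  · exact ⟨hA.choose, hA.choose_spec, by simp⟩
  have inter_le (a) (_ : a ∈ A) (b) (_ : b ∈ A) (hab : a ≠ b) :
      #(layer G (2 * k) S a k ∩ layer G (2 * k) S b k) ≤ k * K * D ^ k / D :=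
    (Nat.le_div_iff_mul_le hD₀).2 (card_layer_inter_layer_mul_le adj hG card_le hab le_rfl)
  obtain ⟨a, ha, hle⟩ := exists_card_mul_sq_le_of_card_inter_le hA
    (fun a ha => pow_le_card_layer adj hG hU le_card (hAU ha) le_rfl) inter_le hDA
  have meets_le : #{b ∈ A | (layer G (2 * k) S a k ∩ layer G (2 * k) S b k).Nonempty} ≤
      #(A ∩ walkBall G (2 * k) a) := by
    refine card_le_card fun b hb => ?_
    obtain ⟨hbA, hmeet⟩ := mem_filter.1 hb
    exact mem_inter.2 ⟨hbA, mem_walkBall_of_layer_inter_layer_nonempty le_rfl hmeet⟩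
  refine ⟨a, ha, ?_⟩
  calc #A * ((D - K) ^ k) ^ 2 * D
      ≤ 2 * Fintype.card V * (#(A ∩ walkBall G (2 * k) a) * (k * K * D ^ k / D)) * D :=
        Nat.mul_le_mul_right D (hle.trans
          (Nat.mul_le_mul_left _ (Nat.mul_le_mul_right _ meets_le)))
    _ = 2 * Fintype.card V * (#(A ∩ walkBall G (2 * k) a) * (k * K * D ^ k / D * D)) := by ring
    _ ≤ 2 * Fintype.card V * (#(A ∩ walkBall G (2 * k) a) * (k * K * D ^ k)) :=
        Nat.mul_le_mul_left _ (Nat.mul_le_mul_left _ (Nat.div_mul_le_self _ _))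

end Branches

/-! ### Removal of a vertex of minimum degree -/

section DeleteVertex
open SimpleGraph

variable {V : Type*} {G : SimpleGraph V}

theorem notMem_support_of_deleteIncidenceSet {v z x : V} (w : (G.deleteIncidenceSet v).Walk z x)
    (hz : z ≠ v) : v ∉ w.support := by
  induction w with
  | nil => simpa using hz.symm
  | cons h w ih =>
    rw [Walk.support_cons, List.mem_cons]
    exact not_or.2 ⟨hz.symm, ih (deleteIncidenceSet_adj.1 h).2.2⟩

theorem support_deleteIncidenceSet_subset_erase [DecidableEq V] {U : Finset V}
    (hU : G.support ⊆ U) (v : V) :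
    (G.deleteIncidenceSet v).support ⊆ U.erase v := by
  rintro x ⟨y, hxy⟩
  obtain ⟨hadj, hxv, -⟩ := deleteIncidenceSet_adj.1 hxy
  exact mem_coe.2 (mem_erase.2 ⟨hxv, hU ⟨y, hadj⟩⟩)

theorem degree_le_degree_deleteIncidenceSet_add_one {u v : V} (huv : u ≠ v)
    [Fintype (G.neighborSet u)] [Fintype ((G.deleteIncidenceSet v).neighborSet u)] :
    G.degree u ≤ (G.deleteIncidenceSet v).degree u + 1 := by
  classical
  simp only [← card_neighborFinset_eq_degree]
  refine (card_le_card fun w hw => ?_).trans (card_insert_le v _)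
  rw [mem_insert, mem_neighborFinset, deleteIncidenceSet_adj]
  exact or_iff_not_imp_left.2 fun hwv => ⟨(G.mem_neighborFinset u w).1 hw, huv, hwv⟩

end DeleteVertex

section Counting
open SimpleGraph
open scoped Classical

variable {V : Type*} [Fintype V] {G : SimpleGraph V} {m K : ℕ}

theorem exists_card_mul_pow_le_card_inter_walkBall {U A : Finset V} {k D : ℕ} {δ : ℝ}
    (hG : FewReturns G (2 * k) K) (hU : G.support ⊆ U) (hD : ∀ u ∈ U, D ≤ G.degree u)
    (hAU : A ⊆ U) (hA : A.Nonempty) (hδ₀ : 0 < δ) (hδK : δ + K ≤ D) (hDδ : D ≤ 2 * δ)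
    (hδA : 2 * Fintype.card V ≤ #A * δ ^ k) :
    ∃ a ∈ A, #A * δ ^ (k + 1) ≤
      2 * Fintype.card V * (#(A ∩ walkBall G (2 * k) a) * (k * K * 2 ^ k)) := by
  have hKD : K ≤ D := by exact_mod_cast (show (K : ℝ) ≤ D by linarith)
  have hδDK : δ ≤ (D - K : ℕ) := by
    rw [Nat.cast_sub hKD]
    linarith
  have hDA : 2 * (Fintype.card V : ℝ) ≤ #A * (D - K : ℕ) ^ k := hδA.trans (by gcongr)
  obtain ⟨a, ha, hle⟩ :=
    exists_card_mul_le_card_inter_walkBall hG hU hD hAU hA (by exact_mod_cast hDA)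
  refine ⟨a, ha, le_of_mul_le_mul_right ?_ (pow_pos hδ₀ k)⟩
  set i := #(A ∩ walkBall G (2 * k) a)
  calc #A * δ ^ (k + 1) * δ ^ k = #A * (δ ^ k) ^ 2 * δ := by ring
    _ ≤ #A * ((D - K : ℕ) ^ k) ^ 2 * D := by
        gcongr
        linarith [K.cast_nonneg (α := ℝ)]
    _ ≤ 2 * Fintype.card V * (i * (k * K * D ^ k)) := by exact_mod_cast hle
    _ ≤ 2 * Fintype.card V * (i * (k * K * (2 * δ) ^ k)) := by gcongr
    _ = 2 * Fintype.card V * (i * (k * K * 2 ^ k)) * δ ^ k := by ring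

theorem exists_card_le_mul_card_inter_walkBall {U A : Finset V} {k d : ℕ} {Λ x : ℝ}
    (hG : FewReturns G (2 * k) K) (hU : G.support ⊆ U) (hd : ∀ u ∈ U, d ≤ G.degree u + 1)
    (hKd : 2 * K + 2 ≤ d) (hx₀ : 0 < x) (hx : x ^ (k + 1) = Fintype.card V) (hxd : x ≤ Λ * d)
    (hAU : A ⊆ U) (hA : (2 * x) ^ (k + 1) / d ^ k < #A) :
    ∃ a ∈ A, (#A : ℝ) ≤ k * K * (4 * Λ) ^ (k + 1) * #(A ∩ walkBall G (2 * k) a) := by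
  obtain ⟨δ, hδ⟩ : ∃ δ : ℝ, (d : ℝ) = 2 * δ := ⟨d / 2, by ring⟩
  have hδK : 2 * (K : ℝ) + 2 ≤ 2 * δ := by exact_mod_cast hδ ▸ Nat.cast_le (α := ℝ).2 hKd
  have hδ₀ : 0 < δ := by linarith [K.cast_nonneg (α := ℝ)]
  have pred_eq : ((d - 1 : ℕ) : ℝ) = 2 * δ - 1 := by
    rw [Nat.cast_sub (by omega), hδ, Nat.cast_one]
  have hA₀ : A.Nonempty := by
    rw [← card_pos, ← Nat.cast_pos (α := ℝ)]
    exact lt_of_le_of_lt (by positivity) hA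
  have hδA : 2 * Fintype.card V ≤ #A * δ ^ k := by
    rw [hδ, div_lt_iff₀ (by positivity)] at hA
    refine le_of_mul_le_mul_left ?_ (pow_pos (two_pos (α := ℝ)) k)
    calc 2 ^ k * (2 * (Fintype.card V : ℝ)) = (2 * x) ^ (k + 1) := by rw [← hx]; ring
      _ ≤ #A * (2 * δ) ^ k := hA.le
      _ = 2 ^ k * (#A * δ ^ k) := by ring
  obtain ⟨a, ha, hle⟩ := exists_card_mul_pow_le_card_inter_walkBall (D := d - 1) hG hU
    (fun u hu => Nat.sub_le_of_le_add (hd u hu)) hAU hA₀ hδ₀ (by linarith) (by linarith) hδA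
  refine ⟨a, ha, le_of_mul_le_mul_right ?_ (pow_pos hδ₀ (k + 1))⟩
  set i := #(A ∩ walkBall G (2 * k) a)
  calc #A * δ ^ (k + 1) ≤ 2 * x ^ (k + 1) * (i * (k * K * 2 ^ k)) := hx ▸ hle
    _ ≤ 2 * (Λ * (2 * δ)) ^ (k + 1) * (i * (k * K * 2 ^ k)) := by
        rw [← hδ]
        gcongr
    _ = k * K * (4 * Λ) ^ (k + 1) * i * δ ^ (k + 1) := by
        have four_pow : (4 : ℝ) ^ (k + 1) = 2 ^ (k + 1) * 2 ^ (k + 1) := by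
          rw [← mul_pow]
          norm_num
        rw [mul_pow 4 Λ, four_pow]
        ring

theorem card_sparseSubsets_walkBall_le {U : Finset V} {k d : ℕ} {Λ x : ℝ} (hK : 1 ≤ K)
    (hG : FewReturns G (2 * k) K) (hU : G.support ⊆ U) (hd : ∀ u ∈ U, d ≤ G.degree u + 1)
    (hΛ₁ : 1 ≤ Λ) (hΛ : (2 : ℝ) ^ Λ = Fintype.card V + 1) (hx : x ^ (k + 1) = Fintype.card V)
    (hΛx : (K + 1) * ((k + 1) * K * (4 * Λ) ^ (k + 1)) * Λ ^ 2 ≤ x) :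
    (#(sparseSubsets (walkBall G (2 * k)) K U d) : ℝ) ≤ 2 ^ ((3 * k + 5) * x) := by
  set b : ℝ := (k + 1) * K * (4 * Λ) ^ (k + 1) with hb_def
  have hb : 2 ≤ b :=
    calc (2 : ℝ) ≤ 4 * Λ := by linarith
      _ ≤ (4 * Λ) ^ (k + 1) := le_self_pow₀ (by linarith) k.succ_ne_zero
      _ ≤ b := le_mul_of_one_le_left (by positivity)
          (one_le_mul_of_one_le_of_one_le (by simp) (by exact_mod_cast hK))
  have hx₀ : 0 < x := lt_of_lt_of_le (by positivity) hΛx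
  have hUΛ : (#U : ℝ) + 1 ≤ 2 ^ Λ := by
    rw [hΛ]
    gcongr
    exact card_le_univ U
  rcases le_total (Λ * d) x with hdx | hxd
  · refine (card_sparseSubsets_le_two_rpow K hUΛ d).trans
      (Real.rpow_le_rpow_of_exponent_le one_le_two (hdx.trans ?_))
    exact le_mul_of_one_le_left hx₀.le (by linarith [k.cast_nonneg (α := ℝ)])
  have hKd : 2 * K + 2 ≤ d := by
    have : Λ * (2 * K + 2) ≤ Λ * d :=
      calc Λ * (2 * K + 2) = (K + 1) * 2 * Λ := by ring
        _ ≤ (K + 1) * b * Λ ^ 2 := by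
          gcongr
          exact le_self_pow₀ hΛ₁ two_ne_zero
        _ ≤ Λ * d := hΛx.trans hxd
    exact_mod_cast le_of_mul_le_mul_left this (by linarith)
  refine card_sparseSubsets_le_of_supersaturated (by linarith) hΛ₁ hUΛ (by omega)
    (fun B hB hBx => ?_) hΛx
  obtain ⟨a, ha, hle⟩ := exists_card_le_mul_card_inter_walkBall hG hU hd hKd hx₀ hx hxd hB hBx
  refine ⟨a, ha, hle.trans ?_⟩
  rw [hb_def]
  gcongr
  linarith

/-- The sets `I ⊆ U` that pass for the neighbourhood of a vertex of minimum degree when that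
vertex is joined to `G`: no larger than the new degree of any vertex of `U`, and such that few
members of `I` are joined by walks of length at most `m`. -/
noncomputable def admissibleNeighborhoods (G : SimpleGraph V) (m K : ℕ) (U : Finset V) :
    Finset (Finset V) :=
  {I ∈ U.powerset | (∀ u ∈ U, #I ≤ G.degree u + 1) ∧ ∀ a ∈ I, #(I ∩ walkBall G m a) ≤ K}

theorem mem_admissibleNeighborhoods {U I : Finset V} :
    I ∈ admissibleNeighborhoods G m K U ↔
      I ⊆ U ∧ (∀ u ∈ U, #I ≤ G.degree u + 1) ∧ ∀ a ∈ I, #(I ∩ walkBall G m a) ≤ K := by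
  simp only [admissibleNeighborhoods, mem_filter, mem_powerset]

theorem card_admissibleNeighborhoods_le {U : Finset V} {k : ℕ} {Λ x : ℝ} (hK : 1 ≤ K)
    (hG : FewReturns G (2 * k) K) (hU : G.support ⊆ U)
    (hΛ₁ : 1 ≤ Λ) (hΛ : (2 : ℝ) ^ Λ = Fintype.card V + 1) (hx : x ^ (k + 1) = Fintype.card V)
    (hΛx : (K + 1) * ((k + 1) * K * (4 * Λ) ^ (k + 1)) * Λ ^ 2 ≤ x) :
    (#(admissibleNeighborhoods G (2 * k) K U) : ℝ) ≤
      (Fintype.card V + 1) * 2 ^ ((3 * k + 5) * x) := by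
  set admissible := admissibleNeighborhoods G (2 * k) K U
  have fiber_le (d : ℕ) : (#{I ∈ admissible | #I = d} : ℝ) ≤ 2 ^ ((3 * k + 5) * x) := by
    rcases eq_empty_or_nonempty {I ∈ admissible | #I = d} with hempty | ⟨J, hJ⟩
    · rw [hempty, card_empty, Nat.cast_zero]
      positivity
    obtain ⟨hJ, hJd⟩ := mem_filter.1 hJ
    obtain ⟨-, hdeg, -⟩ := mem_admissibleNeighborhoods.1 hJ
    refine le_trans (Nat.cast_le.2 (card_le_card fun I hI => ?_))
      (card_sparseSubsets_walkBall_le hK hG hU (hJd ▸ hdeg) hΛ₁ hΛ hx hΛx)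
    obtain ⟨hI, hId⟩ := mem_filter.1 hI
    obtain ⟨hIU, -, hsparse⟩ := mem_admissibleNeighborhoods.1 hI
    exact mem_sparseSubsets.2 ⟨hIU, hId, hsparse⟩
  rw [card_eq_sum_card_fiberwise (f := card) (t := range (Fintype.card V + 1))
    fun I _ => mem_range.2 (Nat.lt_succ_of_le (card_le_univ I)), Nat.cast_sum]
  calc _ ≤ #(range (Fintype.card V + 1)) • (2 : ℝ) ^ ((3 * k + 5) * x) :=
        sum_le_card_nsmul _ _ _ fun d _ => fiber_le d
    _ = (Fintype.card V + 1) * 2 ^ ((3 * k + 5) * x) := by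
        rw [card_range, nsmul_eq_mul]
        push_cast
        rfl

theorem FewReturns.card_neighborFinset_inter_walkBall_le (hG : FewReturns G m K) {v a : V}
    (ha : a ∈ G.neighborFinset v) :
    #(G.neighborFinset v ∩ walkBall (G.deleteIncidenceSet v) m a) ≤ K := by
  have hva : G.Adj v a := (G.mem_neighborFinset v a).1 ha
  refine (card_le_card fun x hx => ?_).trans (hG v a hva)
  obtain ⟨hx, hball⟩ := mem_inter.1 hx
  obtain ⟨w, hw⟩ := mem_walkBall.1 hball
  refine mem_shortReturns.2 ⟨(G.mem_neighborFinset v x).1 hx,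
    w.mapLe (G.deleteIncidenceSet_le v), by simpa using hw, ?_⟩
  simpa using notMem_support_of_deleteIncidenceSet w hva.ne'

theorem FewReturns.neighborFinset_mem_admissibleNeighborhoods (hG : FewReturns G m K)
    {U : Finset V} (hU : G.support ⊆ U) {v : V} (hv : ∀ u ∈ U, G.degree v ≤ G.degree u) :
    G.neighborFinset v ∈
      admissibleNeighborhoods (G.deleteIncidenceSet v) m K (U.erase v) := by
  refine mem_admissibleNeighborhoods.2 ⟨fun x hx => ?_, fun u hu => ?_,
    fun a ha => hG.card_neighborFinset_inter_walkBall_le ha⟩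
  · have hvx : G.Adj v x := (G.mem_neighborFinset v x).1 hx
    exact mem_erase.2 ⟨hvx.ne', hU ⟨v, hvx.symm⟩⟩
  · obtain ⟨huv, hu⟩ := mem_erase.1 hu
    rw [card_neighborFinset_eq_degree]
    refine (hv u hu).trans ((degree_le_degree_deleteIncidenceSet_add_one huv).trans_eq ?_)
    congr!

theorem eq_of_deleteIncidenceSet_eq {G' : SimpleGraph V} {v : V}
    (hdel : G.deleteIncidenceSet v = G'.deleteIncidenceSet v)
    (hnbr : G.neighborFinset v = G'.neighborFinset v) : G = G' := by
  have adj_v (y : V) : G.Adj v y ↔ G'.Adj v y := by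
    rw [← mem_neighborFinset, ← mem_neighborFinset, hnbr]
  ext x y
  by_cases hx : x = v
  · rw [hx, adj_v]
  by_cases hy : y = v
  · rw [hy, G.adj_comm, G'.adj_comm, adj_v]
  · have := congrArg (fun H : SimpleGraph V => H.Adj x y) hdel
    simpa [deleteIncidenceSet_adj, hx, hy] using this

/-- The graphs with few short returns and without edges outside `U`. -/
noncomputable def fewReturnsOn (m K : ℕ) (U : Finset V) : Finset (SimpleGraph V) :=
  {G | FewReturns G m K ∧ G.support ⊆ U}

theorem mem_fewReturnsOn {U : Finset V} :
    G ∈ fewReturnsOn m K U ↔ FewReturns G m K ∧ G.support ⊆ U := by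
  rw [fewReturnsOn, mem_filter_univ]

theorem card_fewReturnsOn_empty_le : #(fewReturnsOn (V := V) m K ∅) ≤ 1 := by
  refine (card_le_card fun G hG => ?_).trans_eq (card_singleton (⊥ : SimpleGraph V))
  have hsupp := (mem_fewReturnsOn.1 hG).2
  rw [coe_empty, Set.subset_empty_iff, support_eq_bot_iff] at hsupp
  exact mem_singleton.2 hsupp

theorem card_fewReturnsOn_of_min_degree_le {B : ℕ} {U : Finset V} {v : V}
    (hB : ∀ G ∈ fewReturnsOn m K (U.erase v), #(admissibleNeighborhoods G m K (U.erase v)) ≤ B) :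
    #{G ∈ fewReturnsOn m K U | ∀ u ∈ U, G.degree v ≤ G.degree u} ≤
      B * #(fewReturnsOn m K (U.erase v)) := by
  have maps (G) (hG : G ∈ {G ∈ fewReturnsOn m K U | ∀ u ∈ U, G.degree v ≤ G.degree u}) :
      G.deleteIncidenceSet v ∈ fewReturnsOn m K (U.erase v) := by
    obtain ⟨hG, hU⟩ := mem_fewReturnsOn.1 (mem_filter.1 hG).1
    exact mem_fewReturnsOn.2 ⟨hG.mono (G.deleteIncidenceSet_le v),
      support_deleteIncidenceSet_subset_erase hU v⟩
  refine card_le_mul_card_image_of_maps_to maps B fun G' hG' => le_trans ?_ (hB G' hG')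
  refine card_le_card_of_injOn (fun G => G.neighborFinset v) (fun G hG => ?_)
    fun G₁ hG₁ G₂ hG₂ hnbr => ?_
  · rw [mem_coe, mem_filter, mem_filter, mem_fewReturnsOn] at hG
    obtain ⟨⟨⟨hG, hU⟩, hmin⟩, rfl⟩ := hG
    exact hG.neighborFinset_mem_admissibleNeighborhoods hU hmin
  · rw [mem_coe, mem_filter] at hG₁ hG₂
    exact eq_of_deleteIncidenceSet_eq (hG₁.2.trans hG₂.2.symm) hnbr

theorem card_fewReturnsOn_le {B : ℕ}
    (hB : ∀ U : Finset V, ∀ G ∈ fewReturnsOn m K U, #(admissibleNeighborhoods G m K U) ≤ B)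
    (U : Finset V) : #(fewReturnsOn m K U) ≤ (Fintype.card V * B) ^ #U := by
  induction hc : #U generalizing U with
  | zero =>
    rw [card_eq_zero.1 hc, pow_zero]
    exact card_fewReturnsOn_empty_le
  | succ c ih =>
    have cover : fewReturnsOn m K U ⊆ U.biUnion fun v =>
        {G ∈ fewReturnsOn m K U | ∀ u ∈ U, G.degree v ≤ G.degree u} := by
      intro G hG
      obtain ⟨v, hv, hmin⟩ := exists_min_image U (fun u => G.degree u) (card_pos.1 (by omega))
      exact mem_biUnion.2 ⟨v, hv, mem_filter.2 ⟨hG, hmin⟩⟩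
    calc #(fewReturnsOn m K U) ≤ #U * (B * (Fintype.card V * B) ^ c) := by
          refine (card_le_card cover).trans (card_biUnion_le_card_mul _ _ _ fun v hv => ?_)
          refine (card_fewReturnsOn_of_min_degree_le (hB _)).trans (Nat.mul_le_mul_left B ?_)
          exact ih _ (by rw [card_erase_of_mem hv, hc, Nat.add_sub_cancel])
      _ ≤ Fintype.card V * (B * (Fintype.card V * B) ^ c) := by
          gcongr
          exact card_le_univ U
      _ = (Fintype.card V * B) ^ (c + 1) := by ring

theorem card_fewReturnsOn_univ_le {k : ℕ} {Λ x : ℝ} (hK : 1 ≤ K) (hΛ₁ : 1 ≤ Λ)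
    (hΛ : (2 : ℝ) ^ Λ = Fintype.card V + 1) (hx : x ^ (k + 1) = Fintype.card V)
    (hΛx : (K + 1) * ((k + 1) * K * (4 * Λ) ^ (k + 1)) * Λ ^ 2 ≤ x) :
    (#(fewReturnsOn (V := V) (2 * k) K univ) : ℝ) ≤
      2 ^ (3 * (k + 2) * (Fintype.card V * x)) := by
  have hK₁ : (1 : ℝ) ≤ K := by exact_mod_cast hK
  have two_mul_le : 2 * Λ ≤ x :=
    calc 2 * Λ = 2 * 1 * Λ := by ring
      _ ≤ (K + 1) * ((k + 1) * K * (4 * Λ) ^ (k + 1)) * Λ ^ 2 := by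
        gcongr
        · linarith
        · exact one_le_mul_of_one_le_of_one_le
            (one_le_mul_of_one_le_of_one_le (by simp) hK₁) (one_le_pow₀ (by linarith))
        · exact le_self_pow₀ hΛ₁ two_ne_zero
      _ ≤ x := hΛx
  set e : ℝ := (3 * k + 5) * x
  have hB (U : Finset V) (G) (hG : G ∈ fewReturnsOn (2 * k) K U) :
      #(admissibleNeighborhoods G (2 * k) K U) ≤ ⌊(2 : ℝ) ^ (Λ + e)⌋₊ := by
    obtain ⟨hG, hU⟩ := mem_fewReturnsOn.1 hG
    refine Nat.le_floor ((card_admissibleNeighborhoods_le hK hG hU hΛ₁ hΛ hx hΛx).trans_eq ?_)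
    rw [← hΛ, ← Real.rpow_add two_pos]
  calc (#(fewReturnsOn (V := V) (2 * k) K univ) : ℝ)
      ≤ (Fintype.card V * ⌊(2 : ℝ) ^ (Λ + e)⌋₊) ^ Fintype.card V := by
        exact_mod_cast card_fewReturnsOn_le hB univ
    _ ≤ (2 ^ Λ * 2 ^ (Λ + e)) ^ Fintype.card V := by
        gcongr
        · linarith
        · exact Nat.floor_le (by positivity)
    _ = 2 ^ ((Λ + (Λ + e)) * Fintype.card V) := by
        rw [← Real.rpow_add two_pos, Real.rpow_mul_natCast two_pos.le]
    _ ≤ 2 ^ ((3 * (k + 2) * x) * Fintype.card V) := by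
        gcongr
        · exact one_le_two
        · linarith
    _ = 2 ^ (3 * (k + 2) * (Fintype.card V * x)) := by ring_nf

end Counting

theorem eventually_mul_logb_pow_le (A : ℝ) (k : ℕ) {s : ℝ} (hs : 0 < s) :
    ∀ᶠ n : ℕ in Filter.atTop, A * Real.logb 2 (n + 1) ^ k ≤ (n : ℝ) ^ s := by
  have isLittleO := ((isLittleO_log_rpow_rpow_atTop (k : ℝ) hs).comp_tendsto
    (Filter.tendsto_atTop_add_const_right Filter.atTop (1 : ℝ)
      tendsto_natCast_atTop_atTop)).const_mul_left (A / Real.log 2 ^ k)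
  filter_upwards [isLittleO.bound (c := 2⁻¹ ^ s) (by positivity), Filter.eventually_ge_atTop 1]
    with n hn hn₁
  have hn₁ : (1 : ℝ) ≤ n := by exact_mod_cast hn₁
  calc A * Real.logb 2 (n + 1) ^ k
      = A / Real.log 2 ^ k * Real.log (n + 1) ^ (k : ℝ) := by
        rw [Real.rpow_natCast, Real.logb, div_pow]
        ring
    _ ≤ 2⁻¹ ^ s * ‖((n : ℝ) + 1) ^ s‖ := (le_abs_self _).trans hn
    _ = (2⁻¹ * (n + 1)) ^ s := by
        rw [Real.norm_of_nonneg (by positivity), Real.mul_rpow (by norm_num) (by positivity)]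
    _ ≤ (n : ℝ) ^ s := by
        gcongr
        linarith

theorem theorem5_general (ℓ : ℕ) (hℓ : 1 ≤ ℓ) (L : ℝ) :
    ∃ N : ℕ, ∀ n : ℕ, N ≤ n →
      ((sparseCycleFamily n (2 * ℓ) L).ncard : ℝ) ≤
        (2 : ℝ) ^ (3 * ((ℓ : ℝ) + 1) * (n : ℝ) ^ (1 + 1 / (ℓ : ℝ))) := by
  obtain ⟨k, rfl⟩ := Nat.exists_eq_add_of_le' hℓ
  set K := 2 * k * ⌊L⌋₊ + 1
  obtain ⟨N, hN⟩ := Filter.eventually_atTop.1 (eventually_mul_logb_pow_le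
    ((K + 1) * ((k + 1) * K * 4 ^ (k + 1))) (k + 3) (s := 1 / (k + 1 : ℕ)) (by positivity))
  refine ⟨max N 1, fun n hn => ?_⟩
  have hn₁ : (1 : ℝ) ≤ n := by exact_mod_cast (le_max_right N 1).trans hn
  have sub : sparseCycleFamily n (2 * (k + 1)) L ⊆ fewReturnsOn (V := Fin n) (2 * k) K univ :=
    fun G hG => mem_fewReturnsOn.2 ⟨fewReturns_of_mem_sparseCycleFamily hG, by simp⟩
  have card_le := card_fewReturnsOn_univ_le (V := Fin n) (k := k) (K := K)
    (Λ := Real.logb 2 (n + 1)) (x := (n : ℝ) ^ (1 / (k + 1 : ℕ) : ℝ)) (by omega)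
    (by rw [Real.le_logb_iff_rpow_le one_lt_two (by linarith), Real.rpow_one]; linarith)
    (by rw [Fintype.card_fin, Real.rpow_logb two_pos (by norm_num) (by linarith)])
    (by rw [Fintype.card_fin, one_div, Real.rpow_inv_natCast_pow (by linarith) (by omega)])
    ((by ring : _ = _).trans_le (hN n ((le_max_left N 1).trans hn)))
  rw [Fintype.card_fin] at card_le
  rw [Real.rpow_add (by linarith), Real.rpow_one, Nat.cast_add_one, add_assoc, one_add_one_eq_two]
  calc ((sparseCycleFamily n (2 * (k + 1)) L).ncard : ℝ)
      ≤ #(fewReturnsOn (V := Fin n) (2 * k) K univ) := by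
        rw [← Set.ncard_coe_finset]
        exact_mod_cast Set.ncard_le_ncard sub
    _ ≤ _ := by simpa using card_le

theorem theorem5 (ℓ : ℕ) (hℓ : 3 ≤ ℓ) (L : ℝ) (hL : 0 < L) :
    ∃ N : ℕ, ∀ n : ℕ, N ≤ n →
      ((sparseCycleFamily n (2 * ℓ) L).ncard : ℝ) ≤
        (2 : ℝ) ^ (3 * ((ℓ : ℝ) + 1) * (n : ℝ) ^ (1 + 1 / (ℓ : ℝ))) :=
  theorem5_general ℓ (by omega) L
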